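/- Let $H$ be a real or complex Hilbert space. For a linear operator $T$ on $H$ with domain $D(T)$ let $R(T)$ be its range; products of operators are taken on their natural domains, $D(ST)=\{x\in D(T): Tx\in D(S)\}$. A densely defined closed linear operator $T$ on $H$ is called EP if $R(T)$ is closed and $R(T)=R(T^*)$. An operator $S$ on $H$ is called positive if $S=S^*$ and $\langle Sx,x\rangle\ge 0$ for all $x\in D(S)$. The modulus $|A|=(A^*A)^{1/2}$ of a densely defined closed operator $A$ is the unique positive operator $S$ with $S^2=A^*A$. Let $A$ be a densely defined closed linear operator on $H$ with closed range. If $A$ is EP, then the following hold (where being EP includes being densely defined, closed, and with closed range): 1. $A^*$ is EP. 2. $AA^*$ is EP. 3. $A^*A$ is EP. 4. The modulus $|A|$ is well defined (there is exactly one positive operator $S$ on $H$ with $S^2=A^*A$), and it is EP. -/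

import Mathlib

open scoped LinearPMap

namespace EPOperator

/-- The product `g f` of two partially defined operators on its natural domain
`{x ∈ D(f) | f x ∈ D(g)}`. -/
def prod {𝕜 E F G : Type*} [Ring 𝕜] [AddCommGroup E] [Module 𝕜 E] [AddCommGroup F] [Module 𝕜 F]
    [AddCommGroup G] [Module 𝕜 G] (g : F →ₗ.[𝕜] G) (f : E →ₗ.[𝕜] F) : E →ₗ.[𝕜] G where
  domain := (g.domain.comap f.toFun).map f.domain.subtype
  toFun :=
    { toFun := fun x => g ⟨f ⟨x.1, by
          obtain ⟨y, -, hy⟩ := x.2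
          exact hy ▸ y.2⟩, by
          obtain ⟨_, y, hy, rfl⟩ := x
          exact hy⟩
      map_add' := fun x y => by
        rw [← LinearPMap.map_add]
        congr 1
        apply Subtype.ext
        exact LinearPMap.map_add f ⟨x.1, _⟩ ⟨y.1, _⟩
      map_smul' := fun c x => by
        rw [RingHom.id_apply, ← LinearPMap.map_smul]
        congr 1
        apply Subtype.ext
        exact LinearPMap.map_smul f c ⟨x.1, _⟩ }

theorem mem_prod_domain {𝕜 E F G : Type*} [Ring 𝕜] [AddCommGroup E] [Module 𝕜 E]
    [AddCommGroup F] [Module 𝕜 F] [AddCommGroup G] [Module 𝕜 G]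
    (g : F →ₗ.[𝕜] G) (f : E →ₗ.[𝕜] F) (x : E) :
    x ∈ (prod g f).domain ↔ ∃ h : x ∈ f.domain, f ⟨x, h⟩ ∈ g.domain := by
  constructor
  · rintro ⟨y, hy, rfl⟩
    exact ⟨y.2, hy⟩
  · rintro ⟨h, hx⟩
    exact ⟨⟨x, h⟩, hx, rfl⟩

theorem prod_apply {𝕜 E F G : Type*} [Ring 𝕜] [AddCommGroup E] [Module 𝕜 E]
    [AddCommGroup F] [Module 𝕜 F] [AddCommGroup G] [Module 𝕜 G]
    (g : F →ₗ.[𝕜] G) (f : E →ₗ.[𝕜] F) (x : (prod g f).domain)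
    (h : (x : E) ∈ f.domain) (h' : f ⟨x, h⟩ ∈ g.domain) :
    prod g f x = g ⟨f ⟨x, h⟩, h'⟩ := rfl

/-- The range of a partially defined operator. -/
def range {𝕜 E F : Type*} [Ring 𝕜] [AddCommGroup E] [Module 𝕜 E] [AddCommGroup F] [Module 𝕜 F]
    (A : E →ₗ.[𝕜] F) : Submodule 𝕜 F :=
  LinearMap.range A.toFun

/-- An EP operator on a Hilbert space: densely defined, closed (closed graph), with closed range
equal to the range of the adjoint. -/
structure IsEP {𝕜 H : Type*} [RCLike 𝕜] [NormedAddCommGroup H] [InnerProductSpace 𝕜 H]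
    [CompleteSpace H] (A : H →ₗ.[𝕜] H) : Prop where
  dense_domain : Dense (A.domain : Set H)
  isClosed : A.IsClosed
  isClosed_range : IsClosed (range A : Set H)
  range_eq : range A = range A†

/-- A positive operator: self-adjoint with nonnegative quadratic form. The form of a self-adjoint
operator is real valued, so it is enough to look at the real part. -/
structure IsPositive {𝕜 H : Type*} [RCLike 𝕜] [NormedAddCommGroup H] [InnerProductSpace 𝕜 H]
    [CompleteSpace H] (S : H →ₗ.[𝕜] H) : Prop where
  isSelfAdjoint : IsSelfAdjoint S
  re_inner_nonneg : ∀ x : S.domain, 0 ≤ RCLike.re (inner 𝕜 (S x) (x : H))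

/-- `S` is a positive square root of `T`: it is positive and `S S = T`, including equality of
the domains. -/
structure IsPositiveSqrt {𝕜 H : Type*} [RCLike 𝕜] [NormedAddCommGroup H] [InnerProductSpace 𝕜 H]
    [CompleteSpace H] (S T : H →ₗ.[𝕜] H) : Prop where
  isPositive : IsPositive S
  prod_self : prod S S = T

/-- `S` is the modulus `|A| = (A* A)^{1/2}`. -/
def IsModulus {𝕜 H : Type*} [RCLike 𝕜] [NormedAddCommGroup H] [InnerProductSpace 𝕜 H]
    [CompleteSpace H] (S A : H →ₗ.[𝕜] H) : Prop :=
  IsPositiveSqrt S (prod A† A)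

end EPOperator

/-!
The rotated graph of `A†` is the orthogonal complement of the graph of `A`. This gives `A†† = A`
and, by solving `x + A† A x = h` with the orthogonal projection onto the graph, the positivity of
`A† A`. If `A` has closed range, then `A†` is bounded below on `range A = (ker A†)ᗮ`, so
`range A†` is closed; moreover `range (A† A) = range A†`, because `A†` kills `(range A)ᗮ`. A
self-adjoint operator with closed range is EP.

A positive operator `T` is determined by the bounded positive operator `R = (1 + T)⁻¹`. With the
bounded roots `C = √R` and `D = √(1 - R)`, the operator `D C⁻¹` is a positive square root of `T`.
If `S` is another one, then `S R` is a bounded positive operator commuting with `R` whose square is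
`R (1 - R)`, hence it equals `C D`, and this forces the graph of `S` into that of `D C⁻¹`.
A closed range passes from `S²` to `S`, because `S² k = 0` implies `S k = 0`.
-/

namespace EPOperator

open scoped InnerProductSpace NNReal

section SqrtSeries

open Finset.HasAntidiagonal (antidiagonal mem_antidiagonal)

/-- The coefficient of `X ^ (n + 1)` in the power series of `1 - √(1 - X)`. As a power series this
is `(X / 2) c(X / 4)`, where `c` is the generating function of the Catalan numbers. -/
noncomputable def sqrtCoeff (n : ℕ) : ℝ := 2 * catalan n / 4 ^ (n + 1)

theorem sqrtCoeff_nonneg (n : ℕ) : 0 ≤ sqrtCoeff n := by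
  unfold sqrtCoeff; positivity

theorem sqrtCoeff_eq_sub (n : ℕ) :
    sqrtCoeff n = n.centralBinom / 4 ^ n - (n + 1).centralBinom / 4 ^ (n + 1) := by
  have h_catalan : ((n : ℝ) + 1) * catalan n = n.centralBinom := by
    exact_mod_cast succ_mul_catalan_eq_centralBinom n
  have h_succ : ((n : ℝ) + 1) * (n + 1).centralBinom = 2 * (2 * n + 1) * n.centralBinom := by
    exact_mod_cast Nat.succ_mul_centralBinom_succ n
  have h_centralBinom : ((n + 1).centralBinom : ℝ) = 2 * (2 * n + 1) * catalan n :=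
    mul_left_cancel₀ (by positivity : (n : ℝ) + 1 ≠ 0) (by rw [h_succ, ← h_catalan]; ring)
  rw [sqrtCoeff, h_centralBinom, ← h_catalan, pow_succ]
  field_simp
  ring

theorem sum_range_sqrtCoeff_le_one (N : ℕ) : ∑ n ∈ Finset.range N, sqrtCoeff n ≤ 1 := by
  simp_rw [sqrtCoeff_eq_sub]
  rw [Finset.sum_range_sub' (fun n : ℕ => (n.centralBinom : ℝ) / 4 ^ n)]
  have : (0 : ℝ) ≤ N.centralBinom / 4 ^ N := by positivity
  simpa using this

theorem summable_sqrtCoeff : Summable sqrtCoeff :=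
  summable_of_sum_range_le sqrtCoeff_nonneg sum_range_sqrtCoeff_le_one

theorem tsum_sqrtCoeff_le_one : ∑' n, sqrtCoeff n ≤ 1 :=
  Real.tsum_le_of_sum_range_le sqrtCoeff_nonneg sum_range_sqrtCoeff_le_one

theorem sum_antidiagonal_sqrtCoeff_mul (n : ℕ) :
    ∑ p ∈ antidiagonal n, sqrtCoeff p.1 * sqrtCoeff p.2 =
      2 * sqrtCoeff (n + 1) := by
  have h_term : ∀ p ∈ antidiagonal n, sqrtCoeff p.1 * sqrtCoeff p.2 =
      4 / 4 ^ (n + 2) * ((catalan p.1 : ℝ) * catalan p.2) := by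
    intro p hp
    rw [mem_antidiagonal] at hp
    rw [← hp, sqrtCoeff, sqrtCoeff]
    field_simp
    ring
  rw [Finset.sum_congr rfl h_term, ← Finset.mul_sum, sqrtCoeff, catalan_succ']
  push_cast
  ring

variable {𝕜 B : Type*} [RCLike 𝕜] [NormedRing B] [NormedAlgebra 𝕜 B]

variable (𝕜) in
/-- The term of degree `n + 1` of the power series of `1 - √(1 - X)`. -/
noncomputable def sqrtTerm (X : B) (n : ℕ) : B := (sqrtCoeff n : 𝕜) • X ^ (n + 1)

variable (𝕜) in
/-- The square root of an element `K` with `‖1 - K‖ ≤ 1`, as a power series in `1 - K`. Unlike the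
continuous functional calculus it also serves for operators on a real Hilbert space. -/
noncomputable def sqrtSeries (K : B) : B := 1 - ∑' n, sqrtTerm 𝕜 (1 - K) n

theorem norm_sqrtTerm_le {X : B} (hX : ‖X‖ ≤ 1) (n : ℕ) : ‖sqrtTerm 𝕜 X n‖ ≤ sqrtCoeff n := by
  rw [sqrtTerm, norm_smul, RCLike.norm_ofReal, abs_of_nonneg (sqrtCoeff_nonneg n)]
  have : ‖X ^ (n + 1)‖ ≤ 1 :=
    (norm_pow_le' X n.succ_pos).trans (pow_le_one₀ (norm_nonneg _) hX)
  exact mul_le_of_le_one_right (sqrtCoeff_nonneg n) this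

theorem summable_norm_sqrtTerm {X : B} (hX : ‖X‖ ≤ 1) : Summable fun n => ‖sqrtTerm 𝕜 X n‖ :=
  summable_sqrtCoeff.of_nonneg_of_le (fun _ => norm_nonneg _) (norm_sqrtTerm_le hX)

theorem norm_one_sub_sqrtSeries_le {K : B} (hK : ‖1 - K‖ ≤ 1) : ‖1 - sqrtSeries 𝕜 K‖ ≤ 1 := by
  rw [sqrtSeries, sub_sub_cancel]
  exact (tsum_of_norm_bounded summable_sqrtCoeff.hasSum (norm_sqrtTerm_le hK)).trans
    tsum_sqrtCoeff_le_one

theorem sum_antidiagonal_sqrtTerm_mul (X : B) (n : ℕ) :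
    ∑ p ∈ antidiagonal n, sqrtTerm 𝕜 X p.1 * sqrtTerm 𝕜 X p.2 =
      (2 : 𝕜) • sqrtTerm 𝕜 X (n + 1) := by
  have h_term : ∀ p ∈ antidiagonal n,
      sqrtTerm 𝕜 X p.1 * sqrtTerm 𝕜 X p.2 =
        ((sqrtCoeff p.1 * sqrtCoeff p.2 : ℝ) : 𝕜) • X ^ (n + 2) := by
    intro p hp
    rw [mem_antidiagonal] at hp
    rw [sqrtTerm, sqrtTerm, smul_mul_smul_comm, ← pow_add, RCLike.ofReal_mul, ← hp]
    congr 2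
    omega
  rw [Finset.sum_congr rfl h_term, ← Finset.sum_smul, ← RCLike.ofReal_sum,
    sum_antidiagonal_sqrtCoeff_mul, sqrtTerm, smul_smul, RCLike.ofReal_mul, RCLike.ofReal_ofNat]

theorem tsum_sqrtTerm_eq_add [CompleteSpace B] {X : B} (hX : ‖X‖ ≤ 1) :
    ∑' n, sqrtTerm 𝕜 X n = (2⁻¹ : 𝕜) • X + ∑' n, sqrtTerm 𝕜 X (n + 1) := by
  have h_zero : sqrtCoeff 0 = 2⁻¹ := by norm_num [sqrtCoeff]
  rw [(summable_norm_sqrtTerm hX).of_norm.tsum_eq_zero_add, sqrtTerm, h_zero, zero_add, pow_one,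
    RCLike.ofReal_inv, RCLike.ofReal_ofNat]

theorem tsum_sqrtTerm_mul_self [CompleteSpace B] {X : B} (hX : ‖X‖ ≤ 1) :
    (∑' n, sqrtTerm 𝕜 X n) * ∑' n, sqrtTerm 𝕜 X n = (2 : 𝕜) • ∑' n, sqrtTerm 𝕜 X n - X := by
  have hs := summable_norm_sqrtTerm (𝕜 := 𝕜) hX
  calc
    _ = (2 : 𝕜) • ∑' n, sqrtTerm 𝕜 X (n + 1) := by
      rw [tsum_mul_tsum_eq_tsum_sum_antidiagonal_of_summable_norm hs hs, ← tsum_const_smul'']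
      exact tsum_congr fun n => sum_antidiagonal_sqrtTerm_mul X n
    _ = _ := by
      rw [tsum_sqrtTerm_eq_add hX, smul_add, smul_smul, mul_inv_cancel₀ two_ne_zero, one_smul,
        add_sub_cancel_left]

theorem sqrtSeries_mul_self [CompleteSpace B] {K : B} (hK : ‖1 - K‖ ≤ 1) :
    sqrtSeries 𝕜 K * sqrtSeries 𝕜 K = K := by
  rw [sqrtSeries, mul_sub, sub_mul, sub_mul, tsum_sqrtTerm_mul_self hK, two_smul]
  simp only [one_mul, mul_one]
  abel

theorem commute_sqrtSeries [CompleteSpace B] {K L : B} (hK : ‖1 - K‖ ≤ 1) (h : Commute L K) :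
    Commute L (sqrtSeries 𝕜 K) := by
  have hs := (summable_norm_sqrtTerm (𝕜 := 𝕜) hK).of_norm
  refine (Commute.one_right L).sub_right ?_
  rw [commute_iff_eq, ← hs.tsum_mul_left, ← hs.tsum_mul_right]
  exact tsum_congr fun n =>
    ((((Commute.one_right L).sub_right h).pow_right (n + 1)).smul_right _).eq

theorem isSelfAdjoint_sqrtSeries [StarRing B] [ContinuousStar B] [StarModule 𝕜 B] {K : B}
    (hK : IsSelfAdjoint K) : IsSelfAdjoint (sqrtSeries 𝕜 K) := by
  refine (IsSelfAdjoint.one B).sub ?_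
  rw [IsSelfAdjoint, tsum_star]
  refine tsum_congr fun n => ?_
  rw [sqrtTerm, star_smul, star_pow, ((IsSelfAdjoint.one B).sub hK).star_eq, RCLike.star_def,
    RCLike.conj_ofReal]

end SqrtSeries

section BoundedPositive

variable {𝕜 H : Type*} [RCLike 𝕜] [NormedAddCommGroup H] [InnerProductSpace 𝕜 H]

theorem abs_re_inner_apply_le (Y : H →L[𝕜] H) (x : H) :
    |RCLike.re ⟪Y x, x⟫_𝕜| ≤ ‖Y‖ * ‖x‖ ^ 2 :=
  calc |RCLike.re ⟪Y x, x⟫_𝕜| ≤ ‖Y x‖ * ‖x‖ :=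
        (RCLike.abs_re_le_norm _).trans (norm_inner_le_norm _ _)
    _ ≤ ‖Y‖ * ‖x‖ * ‖x‖ := by gcongr; exact Y.le_opNorm x
    _ = ‖Y‖ * ‖x‖ ^ 2 := by ring

theorem re_inner_one_sub_apply (Y : H →L[𝕜] H) (x : H) :
    RCLike.re ⟪(1 - Y) x, x⟫_𝕜 = ‖x‖ ^ 2 - RCLike.re ⟪Y x, x⟫_𝕜 := by
  rw [sub_apply, one_apply_eq_self, inner_sub_left, map_sub, inner_self_eq_norm_sq]

theorem isPositive_of_norm_one_sub_le_one [CompleteSpace H] {K : H →L[𝕜] H}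
    (hKs : IsSelfAdjoint K) (hK : ‖1 - K‖ ≤ 1) : K.IsPositive := by
  refine ⟨hKs.isSymmetric, fun x => ?_⟩
  have h := (abs_le.1 (abs_re_inner_apply_le (1 - K) x)).2
  rw [re_inner_one_sub_apply] at h
  have : ‖1 - K‖ * ‖x‖ ^ 2 ≤ 1 * ‖x‖ ^ 2 := by gcongr
  change 0 ≤ RCLike.re ⟪K x, x⟫_𝕜
  linarith

theorem norm_one_sub_le_one_of_isPositive {K : H →L[𝕜] H} (hK : K.IsPositive) (hK1 : ‖K‖ ≤ 1) :
    ‖1 - K‖ ≤ 1 := by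
  have hs : (1 - K).IsSymmetric := LinearMap.IsSymmetric.one.sub hK.isSymmetric
  rw [(1 - K).norm_eq_iSup_rayleighQuotient hs]
  refine ciSup_le fun x => ?_
  have h_le := (abs_le.1 (abs_re_inner_apply_le K x)).2.trans
    (mul_le_mul_of_nonneg_right hK1 (sq_nonneg ‖x‖))
  have h_nonneg := hK.re_inner_nonneg_left x
  rw [ContinuousLinearMap.rayleighQuotient, ContinuousLinearMap.reApplyInnerSelf_apply,
    re_inner_one_sub_apply, abs_div, abs_sq]
  refine div_le_one_of_le₀ (abs_le.2 ⟨?_, ?_⟩) (sq_nonneg _) <;> linarith [sq_nonneg ‖x‖]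

variable [CompleteSpace H]

theorem exists_isPositive_sqrt_of_norm_le_one {K : H →L[𝕜] H} (hK : K.IsPositive)
    (hK1 : ‖K‖ ≤ 1) : ∃ R : H →L[𝕜] H, R.IsPositive ∧ R * R = K ∧ ∀ L, Commute L K → Commute L R :=
  have h := norm_one_sub_le_one_of_isPositive hK hK1
  ⟨sqrtSeries 𝕜 K, isPositive_of_norm_one_sub_le_one (isSelfAdjoint_sqrtSeries hK.isSelfAdjoint)
    (norm_one_sub_sqrtSeries_le h), sqrtSeries_mul_self h, fun _ => commute_sqrtSeries h⟩

theorem exists_isPositive_sqrt {K : H →L[𝕜] H} (hK : K.IsPositive) :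
    ∃ R : H →L[𝕜] H, R.IsPositive ∧ R * R = K ∧ ∀ L, Commute L K → Commute L R := by
  obtain ⟨c, hc, hKc⟩ : ∃ c : ℝ, 0 < c ∧ ‖K‖ ≤ c := ⟨‖K‖ + 1, by positivity, by linarith⟩
  have h_norm : ‖((c⁻¹ : ℝ) : 𝕜) • K‖ ≤ 1 := by
    rw [norm_smul, RCLike.norm_ofReal, abs_of_pos (inv_pos.2 hc)]
    exact inv_mul_le_one_of_le₀ hKc hc.le
  obtain ⟨R, hR, hRR, hRc⟩ := exists_isPositive_sqrt_of_norm_le_one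
    (hK.smul_of_nonneg (RCLike.ofReal_nonneg.2 (inv_pos.2 hc).le)) h_norm
  refine ⟨((√c : ℝ) : 𝕜) • R, hR.smul_of_nonneg (RCLike.ofReal_nonneg.2 (Real.sqrt_nonneg c)),
    ?_, fun L hL => (hRc L (hL.smul_right _)).smul_right _⟩
  rw [smul_mul_smul_comm, hRR, smul_smul, ← RCLike.ofReal_mul, ← RCLike.ofReal_mul,
    Real.mul_self_sqrt hc.le, mul_inv_cancel₀ hc.ne', RCLike.ofReal_one, one_smul]

theorem apply_eq_zero_of_re_inner_eq_zero {K : H →L[𝕜] H} (hK : K.IsPositive) {x : H}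
    (hx : RCLike.re ⟪K x, x⟫_𝕜 = 0) : K x = 0 := by
  obtain ⟨G, hG, rfl, -⟩ := exists_isPositive_sqrt hK
  rw [mul_apply_eq_comp, hG.inner_left_eq_inner_right,
    inner_self_eq_norm_sq, sq_eq_zero_iff, norm_eq_zero] at hx
  rw [mul_apply_eq_comp, hx, map_zero]

theorem isPositive_mul_of_commute {C D : H →L[𝕜] H} (hC : C.IsPositive) (hD : D.IsPositive)
    (h : Commute C D) : (C * D).IsPositive := by
  obtain ⟨E, hE, rfl, hEc⟩ := exists_isPositive_sqrt hC
  have hED : E * E * D = E * D * E := by rw [mul_assoc E D, (hEc D h.symm).eq, mul_assoc]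
  rw [hED]
  have h_conj := hD.conj_adjoint E
  rwa [hE.isSelfAdjoint.adjoint_eq] at h_conj

theorem eq_of_mul_self_eq_mul_self {G K : H →L[𝕜] H} (hG : G.IsPositive) (hK : K.IsPositive)
    (hc : Commute G K) (h : G * G = K * K) : G = K := by
  ext x
  set z := (K - G) x with hz
  have h_sum : K z + G z = 0 := by
    have : (K + G) * (K - G) = 0 := by rw [← hc.symm.mul_self_sub_mul_self_eq, h, sub_self]
    exact DFunLike.congr_fun this x
  have h_re : RCLike.re ⟪K z, z⟫_𝕜 + RCLike.re ⟪G z, z⟫_𝕜 = 0 := by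
    rw [← map_add, ← inner_add_left, h_sum, inner_zero_left, map_zero]
  have hGz_nonneg := hG.re_inner_nonneg_left z
  have hKz_nonneg := hK.re_inner_nonneg_left z
  have hKz : K z = 0 := apply_eq_zero_of_re_inner_eq_zero hK (by linarith)
  have hGz : G z = 0 := apply_eq_zero_of_re_inner_eq_zero hG (by linarith)
  have hz0 : ⟪z, z⟫_𝕜 = 0 := by
    nth_rw 1 [hz]
    rw [sub_apply, inner_sub_left, hK.inner_left_eq_inner_right, hG.inner_left_eq_inner_right,
      hKz, hGz, sub_self]
  exact (sub_eq_zero.1 (inner_self_eq_zero.1 hz0)).symm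

end BoundedPositive

section Graph

variable {𝕜 E F G : Type*} [Ring 𝕜] [AddCommGroup E] [Module 𝕜 E] [AddCommGroup F] [Module 𝕜 F]
  [AddCommGroup G] [Module 𝕜 G]

theorem mem_graph_prod_iff {g : F →ₗ.[𝕜] G} {f : E →ₗ.[𝕜] F} {x : E} {z : G} :
    (x, z) ∈ (prod g f).graph ↔ ∃ y, (x, y) ∈ f.graph ∧ (y, z) ∈ g.graph := by
  simp only [LinearPMap.mem_graph_iff]
  constructor
  · rintro ⟨⟨x', hx'⟩, rfl, rfl⟩
    obtain ⟨hf, hg⟩ := (mem_prod_domain g f x').1 hx'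
    exact ⟨f ⟨x', hf⟩, ⟨⟨x', hf⟩, rfl, rfl⟩, ⟨⟨_, hg⟩, rfl, rfl⟩⟩
  · rintro ⟨_, ⟨a, rfl, rfl⟩, ⟨b, hb, rfl⟩⟩
    have hfa : f a ∈ g.domain := hb ▸ b.2
    refine ⟨⟨a, (mem_prod_domain g f a).2 ⟨a.2, hfa⟩⟩, rfl, ?_⟩
    rw [prod_apply g f _ a.2 hfa]
    exact congrArg g (Subtype.ext hb.symm)

theorem mem_range_iff {A : E →ₗ.[𝕜] F} {y : F} : y ∈ range A ↔ ∃ x, (x, y) ∈ A.graph := by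
  simp [range, LinearPMap.mem_graph_iff]

theorem mem_range_of_mem_graph {A : E →ₗ.[𝕜] F} {x : E} {y : F} (h : (x, y) ∈ A.graph) :
    y ∈ range A :=
  mem_range_iff.2 ⟨x, h⟩

theorem range_prod_le (g : F →ₗ.[𝕜] G) (f : E →ₗ.[𝕜] F) : range (prod g f) ≤ range g := by
  intro z hz
  obtain ⟨x, hx⟩ := mem_range_iff.1 hz
  obtain ⟨y, -, hyz⟩ := mem_graph_prod_iff.1 hx
  exact mem_range_of_mem_graph hyz

theorem eq_of_forall_mem_graph_iff {A B : E →ₗ.[𝕜] F}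
    (h : ∀ x y, (x, y) ∈ A.graph ↔ (x, y) ∈ B.graph) : A = B :=
  LinearPMap.eq_of_eq_graph (Submodule.ext fun p => h p.1 p.2)

end Graph

section ClosedRange

variable {𝕜 E F : Type*} [NontriviallyNormedField 𝕜] [NormedAddCommGroup E] [NormedSpace 𝕜 E]
  [CompleteSpace E] [NormedAddCommGroup F] [NormedSpace 𝕜 F] [CompleteSpace F]

theorem isClosed_map_snd_of_norm_fst_le {g : Submodule 𝕜 (E × F)}
    (hg : IsClosed (g : Set (E × F))) {C : ℝ} (h : ∀ x y, (x, y) ∈ g → ‖x‖ ≤ C * ‖y‖) :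
    IsClosed (g.map (LinearMap.snd 𝕜 E F) : Set F) := by
  have : CompleteSpace g := hg.completeSpace_coe
  set f : g →L[𝕜] F := (ContinuousLinearMap.snd 𝕜 E F).comp g.subtypeL
  have h_bound : ∀ p : g, ‖p‖ ≤ (max 1 C).toNNReal * ‖f p‖ := by
    rintro ⟨⟨x, y⟩, hp⟩
    rw [Real.coe_toNNReal _ (zero_le_one.trans (le_max_left 1 C))]
    refine max_le ((h x y hp).trans ?_) ?_
    · exact mul_le_mul_of_nonneg_right (le_max_right 1 C) (norm_nonneg y)
    · exact le_mul_of_one_le_left (norm_nonneg y) (le_max_left 1 C)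
  have h_range : (g.map (LinearMap.snd 𝕜 E F) : Set F) = Set.range f := by
    ext y
    simp [f]
  rw [h_range]
  exact (AddMonoidHomClass.antilipschitz_of_bound f h_bound).isClosed_range f.uniformContinuous

theorem exists_mem_graph_norm_le {A : E →ₗ.[𝕜] F} (hc : A.IsClosed)
    (hr : IsClosed (range A : Set F)) :
    ∃ C > 0, ∀ y ∈ range A, ∃ x, (x, y) ∈ A.graph ∧ ‖x‖ ≤ C * ‖y‖ := by
  have : CompleteSpace A.graph := IsClosed.completeSpace_coe (hs := hc)
  have : CompleteSpace (range A) := hr.completeSpace_coe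
  set f : A.graph →L[𝕜] range A :=
    ((ContinuousLinearMap.snd 𝕜 E F).comp A.graph.subtypeL).codRestrict (range A)
      fun p => mem_range_of_mem_graph p.2
  have h_surj : Function.Surjective f := by
    rintro ⟨y, hy⟩
    obtain ⟨x, hx⟩ := mem_range_iff.1 hy
    exact ⟨⟨(x, y), hx⟩, rfl⟩
  obtain ⟨C, hC_pos, hC⟩ := f.exists_preimage_norm_le h_surj
  refine ⟨C, hC_pos, fun y hy => ?_⟩
  obtain ⟨⟨⟨x, y'⟩, hp⟩, hpy, h_norm⟩ := hC ⟨y, hy⟩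
  obtain rfl : y' = y := congrArg Subtype.val hpy
  exact ⟨x, hp, (norm_fst_le (x, y')).trans h_norm⟩

end ClosedRange

section Adjoint

variable {𝕜 E F : Type*} [RCLike 𝕜] [NormedAddCommGroup E] [InnerProductSpace 𝕜 E]
  [NormedAddCommGroup F] [InnerProductSpace 𝕜 F] {A : E →ₗ.[𝕜] F}

/-- The graph of an operator as a subspace of the Hilbert sum of the two spaces. The product
`E × F` carries the sup norm, so that orthogonality of graphs makes sense only here. -/
def hilbertGraph (A : E →ₗ.[𝕜] F) : Submodule 𝕜 (WithLp 2 (E × F)) :=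
  A.graph.comap (WithLp.linearEquiv 2 𝕜 (E × F)).toLinearMap

theorem isClosed_hilbertGraph (hc : A.IsClosed) :
    IsClosed (hilbertGraph A : Set (WithLp 2 (E × F))) :=
  IsClosed.preimage (WithLp.prod_continuous_ofLp 2 E F) hc

variable [CompleteSpace E]

theorem dense_domain_of_forall_inner_eq_zero
    (h : ∀ z, (∀ x y, (x, y) ∈ A.graph → ⟪x, z⟫_𝕜 = 0) → z = 0) : Dense (A.domain : Set E) := by
  rw [Submodule.dense_iff_topologicalClosure_eq_top, Submodule.topologicalClosure_eq_top_iff,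
    Submodule.eq_bot_iff]
  exact fun z hz => h z fun x y hxy =>
    (Submodule.mem_orthogonal _ _).1 hz x (LinearPMap.mem_domain_of_mem_graph hxy)

theorem mem_graph_adjoint_iff (hd : Dense (A.domain : Set E)) {u : F} {v : E} :
    (u, v) ∈ A†.graph ↔ ∀ x y, (x, y) ∈ A.graph → ⟪y, u⟫_𝕜 = ⟪x, v⟫_𝕜 := by
  rw [LinearPMap.adjoint_graph_eq_graph_adjoint hd, Submodule.mem_adjoint_iff]
  simp only [sub_eq_zero]

theorem mem_orthogonal_hilbertGraph_iff (hd : Dense (A.domain : Set E)) {p : WithLp 2 (E × F)} :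
    p ∈ (hilbertGraph A)ᗮ ↔ (-p.snd, p.fst) ∈ A†.graph := by
  rw [mem_graph_adjoint_iff hd, Submodule.mem_orthogonal]
  constructor
  · intro h x y hxy
    have h_inner := h (WithLp.toLp 2 (x, y)) hxy
    rw [WithLp.prod_inner_apply] at h_inner
    rw [inner_neg_right]
    exact (eq_neg_of_add_eq_zero_left h_inner).symm
  · intro h q hq
    rw [WithLp.prod_inner_apply, ← eq_neg_iff_add_eq_zero, ← inner_neg_right]
    exact (h _ _ hq).symm

theorem mem_orthogonal_range_iff (hd : Dense (A.domain : Set E)) {u : F} :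
    u ∈ (range A)ᗮ ↔ (u, 0) ∈ A†.graph := by
  simp only [mem_graph_adjoint_iff hd, Submodule.mem_orthogonal, mem_range_iff, inner_zero_right]
  exact ⟨fun h x y hxy => h y ⟨x, hxy⟩, fun h y ⟨x, hxy⟩ => h x y hxy⟩

variable [CompleteSpace F]

theorem mem_graph_iff_of_isClosed (hd : Dense (A.domain : Set E)) (hc : A.IsClosed) {u : E}
    {v : F} : (u, v) ∈ A.graph ↔ ∀ w z, (w, z) ∈ A†.graph → ⟪z, u⟫_𝕜 = ⟪w, v⟫_𝕜 := by
  have : CompleteSpace (hilbertGraph A) := (isClosed_hilbertGraph hc).completeSpace_coe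
  have h_mem : (u, v) ∈ A.graph ↔ WithLp.toLp 2 (u, v) ∈ (hilbertGraph A)ᗮᗮ := by
    rw [Submodule.orthogonal_orthogonal]; rfl
  rw [h_mem, Submodule.mem_orthogonal]
  constructor
  · intro h w z hwz
    have h_inner := h (WithLp.toLp 2 (z, -w))
      ((mem_orthogonal_hilbertGraph_iff hd).2 (by simpa using hwz))
    rw [WithLp.prod_inner_apply] at h_inner
    simpa [add_neg_eq_zero] using h_inner
  · intro h p hp
    have h_inner := h _ _ ((mem_orthogonal_hilbertGraph_iff hd).1 hp)
    rw [inner_neg_left] at h_inner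
    rw [WithLp.prod_inner_apply]
    exact add_eq_zero_iff_eq_neg.2 h_inner

theorem dense_domain_adjoint (hd : Dense (A.domain : Set E)) (hc : A.IsClosed) :
    Dense (A†.domain : Set F) := by
  refine dense_domain_of_forall_inner_eq_zero fun k hk => ?_
  have h_graph : ((0 : E), k) ∈ A.graph := (mem_graph_iff_of_isClosed hd hc).2 fun w z hwz => by
    rw [inner_zero_right, hk w z hwz]
  exact A.graph_fst_eq_zero_snd h_graph rfl

theorem adjoint_adjoint_eq (hd : Dense (A.domain : Set E)) (hc : A.IsClosed) : A†† = A :=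
  eq_of_forall_mem_graph_iff fun _ _ => by
    rw [mem_graph_adjoint_iff (dense_domain_adjoint hd hc), mem_graph_iff_of_isClosed hd hc]

theorem exists_mem_graph_adjoint_of_mem_range (hd : Dense (A.domain : Set E))
    (hr : IsClosed (range A : Set F)) {v : E} (hv : v ∈ range A†) :
    ∃ u ∈ range A, (u, v) ∈ A†.graph := by
  obtain ⟨u, hu⟩ := mem_range_iff.1 hv
  have : CompleteSpace (range A) := hr.completeSpace_coe
  obtain ⟨p, hp, q, hq, rfl⟩ := (range A).exists_add_mem_mem_orthogonal u
  have hpq := sub_mem hu ((mem_orthogonal_range_iff hd).1 hq)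
  rw [Prod.mk_sub_mk, add_sub_cancel_right, sub_zero] at hpq
  exact ⟨p, hp, hpq⟩

theorem range_prod_adjoint_self (hd : Dense (A.domain : Set E))
    (hr : IsClosed (range A : Set F)) : range (prod A† A) = range A† := by
  refine le_antisymm (range_prod_le _ _) fun v hv => ?_
  obtain ⟨u, hu, huv⟩ := exists_mem_graph_adjoint_of_mem_range hd hr hv
  obtain ⟨x, hx⟩ := mem_range_iff.1 hu
  exact mem_range_of_mem_graph (mem_graph_prod_iff.2 ⟨u, hx, huv⟩)

theorem isClosed_range_adjoint (hd : Dense (A.domain : Set E)) (hc : A.IsClosed)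
    (hr : IsClosed (range A : Set F)) : IsClosed (range A† : Set E) := by
  obtain ⟨C, hC_pos, hC⟩ := exists_mem_graph_norm_le hc hr
  set g : Submodule 𝕜 (F × E) := A†.graph ⊓ (range A).comap (LinearMap.fst 𝕜 F E)
  have hg : IsClosed (g : Set (F × E)) :=
    (LinearPMap.adjoint_isClosed hd).inter (hr.preimage continuous_fst)
  have h_range : range A† = g.map (LinearMap.snd 𝕜 F E) := by
    ext v
    constructor
    · intro hv
      obtain ⟨u, hu, huv⟩ := exists_mem_graph_adjoint_of_mem_range hd hr hv
      exact ⟨(u, v), ⟨huv, hu⟩, rfl⟩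
    · rintro ⟨⟨u, v⟩, ⟨huv, -⟩, rfl⟩
      exact mem_range_of_mem_graph huv
  rw [h_range]
  refine isClosed_map_snd_of_norm_fst_le (C := C) hg ?_
  rintro u v ⟨huv, hu⟩
  obtain ⟨x, hxu, hx⟩ := hC u hu
  rcases eq_or_ne u 0 with rfl | hu0
  · rw [norm_zero]
    positivity
  refine le_of_mul_le_mul_right ?_ (norm_pos_iff.2 hu0)
  calc ‖u‖ * ‖u‖ = RCLike.re ⟪u, u⟫_𝕜 := (inner_self_eq_norm_mul_norm u).symm
    _ = RCLike.re ⟪x, v⟫_𝕜 := by rw [(mem_graph_adjoint_iff hd).1 huv x u hxu]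
    _ ≤ ‖x‖ * ‖v‖ := re_inner_le_norm x v
    _ ≤ C * ‖u‖ * ‖v‖ := by gcongr
    _ = C * ‖v‖ * ‖u‖ := by ring

end Adjoint

section UnboundedPositive

variable {𝕜 E F H : Type*} [RCLike 𝕜] [NormedAddCommGroup E] [InnerProductSpace 𝕜 E]
  [CompleteSpace E] [NormedAddCommGroup F] [InnerProductSpace 𝕜 F] [CompleteSpace F]
  [NormedAddCommGroup H] [InnerProductSpace 𝕜 H] [CompleteSpace H] {S T : H →ₗ.[𝕜] H}

theorem adjoint_eq_of_isSelfAdjoint (hT : IsSelfAdjoint T) : T† = T := hT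

theorem mem_graph_iff_of_isSelfAdjoint (hT : IsSelfAdjoint T) {u v : H} :
    (u, v) ∈ T.graph ↔ ∀ x y, (x, y) ∈ T.graph → ⟪y, u⟫_𝕜 = ⟪x, v⟫_𝕜 := by
  rw [← mem_graph_adjoint_iff hT.dense_domain, adjoint_eq_of_isSelfAdjoint hT]

theorem inner_eq_of_isSelfAdjoint (hT : IsSelfAdjoint T) {x y u v : H} (hxy : (x, y) ∈ T.graph)
    (huv : (u, v) ∈ T.graph) : ⟪y, u⟫_𝕜 = ⟪x, v⟫_𝕜 :=
  (mem_graph_iff_of_isSelfAdjoint hT).1 huv x y hxy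

theorem eq_of_isSelfAdjoint_of_graph_le (hS : IsSelfAdjoint S) (hT : IsSelfAdjoint T)
    (h : S.graph ≤ T.graph) : S = T :=
  eq_of_forall_mem_graph_iff fun _ _ => ⟨fun huv => h huv, fun huv =>
    (mem_graph_iff_of_isSelfAdjoint hS).2 fun _ _ hxy => inner_eq_of_isSelfAdjoint hT (h hxy) huv⟩

theorem IsPositive.re_inner_nonneg_of_mem_graph (hT : IsPositive T) {x y : H}
    (hxy : (x, y) ∈ T.graph) : 0 ≤ RCLike.re ⟪y, x⟫_𝕜 := by
  obtain ⟨a, rfl, rfl⟩ := (LinearPMap.mem_graph_iff T).1 hxy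
  exact hT.re_inner_nonneg a

theorem dense_domain_of_forall_exists_add
    (hn : ∀ x y, (x, y) ∈ T.graph → 0 ≤ RCLike.re ⟪y, x⟫_𝕜)
    (hs : ∀ h, ∃ x y, (x, y) ∈ T.graph ∧ x + y = h) : Dense (T.domain : Set H) := by
  refine dense_domain_of_forall_inner_eq_zero fun h hh => ?_
  obtain ⟨x, y, hxy, rfl⟩ := hs h
  have h_re := congrArg RCLike.re (hh x y hxy)
  rw [inner_add_right, map_add, inner_self_eq_norm_sq, inner_re_symm, map_zero] at h_re
  have h_sq : ‖x‖ ^ 2 = 0 := le_antisymm (by linarith [hn x y hxy]) (sq_nonneg _)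
  obtain rfl : x = 0 := norm_eq_zero.1 (sq_eq_zero_iff.1 h_sq)
  rw [T.graph_fst_eq_zero_snd hxy rfl, add_zero]

theorem isPositive_of_forall_exists_add
    (hsymm : ∀ x y u v, (x, y) ∈ T.graph → (u, v) ∈ T.graph → ⟪y, u⟫_𝕜 = ⟪x, v⟫_𝕜)
    (hn : ∀ x y, (x, y) ∈ T.graph → 0 ≤ RCLike.re ⟪y, x⟫_𝕜)
    (hs : ∀ h, ∃ x y, (x, y) ∈ T.graph ∧ x + y = h) : IsPositive T := by
  have hd := dense_domain_of_forall_exists_add hn hs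
  have h_le : T.graph ≤ T†.graph := fun ⟨u, v⟩ huv =>
    (mem_graph_adjoint_iff hd).2 fun x y hxy => hsymm x y u v hxy huv
  refine ⟨LinearPMap.isSelfAdjoint_def.2 (eq_of_forall_mem_graph_iff fun u v =>
    ⟨fun huv => ?_, fun huv => h_le huv⟩), fun x => hn _ _ (T.mem_graph x)⟩
  -- The difference `d` of `u` and the solution `x` of `(1 + T) x = u + v` satisfies `T† d = -d`.
  obtain ⟨x, y, hxy, h_add⟩ := hs (u + v)
  obtain ⟨a, b, hab, h_sub⟩ := hs (u - x)
  have h_neg : v - y = -(u - x) := by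
    rw [← add_eq_zero_iff_eq_neg, ← sub_eq_zero.2 h_add.symm]; abel
  have h_adjoint : (u - x, v - y) ∈ T†.graph := sub_mem huv (h_le hxy)
  have h_inner := (mem_graph_adjoint_iff hd).1 h_adjoint a b hab
  rw [h_neg, inner_neg_right, eq_neg_iff_add_eq_zero, add_comm, ← inner_add_left, h_sub,
    inner_self_eq_zero, sub_eq_zero] at h_inner
  obtain rfl := h_inner
  rwa [← add_left_cancel h_add]

/-- Von Neumann's theorem. -/
theorem isPositive_prod_adjoint_self {A : E →ₗ.[𝕜] F} (hd : Dense (A.domain : Set E))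
    (hc : A.IsClosed) : IsPositive (prod A† A) := by
  have h_adjoint {u : F} {v x : E} {y : F} (huv : (u, v) ∈ A†.graph) (hxy : (x, y) ∈ A.graph) :
      ⟪y, u⟫_𝕜 = ⟪x, v⟫_𝕜 := (mem_graph_adjoint_iff hd).1 huv x y hxy
  refine isPositive_of_forall_exists_add (fun x y u v hxy huv => ?_) (fun x y hxy => ?_)
    fun h => ?_
  · obtain ⟨a, hxa, hay⟩ := mem_graph_prod_iff.1 hxy
    obtain ⟨b, hub, hbv⟩ := mem_graph_prod_iff.1 huv
    rw [← h_adjoint hbv hxa, ← inner_conj_symm, ← h_adjoint hay hub, inner_conj_symm]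
  · obtain ⟨a, hxa, hay⟩ := mem_graph_prod_iff.1 hxy
    rw [inner_re_symm, ← h_adjoint hay hxa]
    exact inner_self_nonneg
  · have : CompleteSpace (hilbertGraph A) := (isClosed_hilbertGraph hc).completeSpace_coe
    obtain ⟨p, hp, q, hq, hpq⟩ :=
      (hilbertGraph A).exists_add_mem_mem_orthogonal (WithLp.toLp 2 (h, 0))
    have h_fst : h = p.fst + q.fst := congrArg WithLp.fst hpq
    have h_snd : 0 = p.snd + q.snd := congrArg WithLp.snd hpq
    have hq' := (mem_orthogonal_hilbertGraph_iff hd).1 hq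
    rw [← eq_neg_of_add_eq_zero_left h_snd.symm] at hq'
    exact ⟨p.fst, q.fst, mem_graph_prod_iff.2 ⟨p.snd, hp, hq'⟩, h_fst.symm⟩

theorem IsPositive.norm_le_norm_add (hT : IsPositive T) {x y : H} (hxy : (x, y) ∈ T.graph) :
    ‖x‖ ≤ ‖x + y‖ := by
  have h_nonneg := hT.re_inner_nonneg_of_mem_graph hxy
  rw [inner_re_symm] at h_nonneg
  have h_sq := norm_add_sq (𝕜 := 𝕜) x y
  exact le_of_sq_le_sq (by nlinarith [sq_nonneg ‖y‖]) (norm_nonneg _)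

end UnboundedPositive

section Resolvent

variable {𝕜 H : Type*} [RCLike 𝕜] [NormedAddCommGroup H] [InnerProductSpace 𝕜 H]

/-- The operator `1 + T`, as a bounded operator on the graph of `T`. -/
def oneAdd (T : H →ₗ.[𝕜] H) : T.graph →L[𝕜] H :=
  (ContinuousLinearMap.fst 𝕜 H H + ContinuousLinearMap.snd 𝕜 H H).comp T.graph.subtypeL

/-- `R` is the bounded inverse `(1 + T)⁻¹`, encoded without mentioning domains. -/
def IsInvOneAdd (R : H →L[𝕜] H) (T : H →ₗ.[𝕜] H) : Prop :=
  ∀ x y, (x, y) ∈ T.graph ↔ R (x + y) = x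

variable {T : H →ₗ.[𝕜] H} {R : H →L[𝕜] H}

theorem IsInvOneAdd.mem_graph (hR : IsInvOneAdd R T) (h : H) : (R h, h - R h) ∈ T.graph := by
  rw [hR, add_sub_cancel]

theorem IsInvOneAdd.injective (hR : IsInvOneAdd R T) : Function.Injective R :=
  (injective_iff_map_eq_zero R).2 fun h hh => by
    have h_graph := hR.mem_graph h
    rw [hh, sub_zero] at h_graph
    exact T.graph_fst_eq_zero_snd h_graph rfl

variable [CompleteSpace H]

theorem IsPositive.norm_le_oneAdd (hT : IsPositive T) (p : T.graph) :
    ‖p‖ ≤ (2 : ℝ≥0) * ‖oneAdd T p‖ := by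
  obtain ⟨⟨x, y⟩, hxy⟩ := p
  have hx : ‖x‖ ≤ ‖x + y‖ := hT.norm_le_norm_add hxy
  have hy : ‖y‖ ≤ ‖x + y‖ + ‖x‖ := by
    simpa using norm_sub_le (x + y) x
  change max ‖x‖ ‖y‖ ≤ 2 * ‖x + y‖
  exact max_le (by linarith [norm_nonneg (x + y)]) (by linarith)

theorem IsPositive.bijective_oneAdd (hT : IsPositive T) : Function.Bijective (oneAdd T) := by
  have : CompleteSpace T.graph := IsClosed.completeSpace_coe (hs := hT.isSelfAdjoint.isClosed)
  have h_lipschitz := AddMonoidHomClass.antilipschitz_of_bound (oneAdd T) hT.norm_le_oneAdd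
  have h_closed : IsClosed ((oneAdd T).toLinearMap.range : Set H) :=
    h_lipschitz.isClosed_range (oneAdd T).uniformContinuous
  refine ⟨h_lipschitz.injective, LinearMap.range_eq_top.1 ?_⟩
  have : CompleteSpace (oneAdd T).toLinearMap.range := h_closed.completeSpace_coe
  rw [← Submodule.orthogonal_eq_bot_iff, Submodule.eq_bot_iff]
  intro z hz
  have hz_inner : ∀ x y, (x, y) ∈ T.graph → ⟪x, z⟫_𝕜 + ⟪y, z⟫_𝕜 = 0 := fun x y hxy => by
    rw [← inner_add_left]
    exact (Submodule.mem_orthogonal _ _).1 hz _ ⟨⟨(x, y), hxy⟩, rfl⟩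
  have hz_graph : (z, -z) ∈ T.graph :=
    (mem_graph_iff_of_isSelfAdjoint hT.isSelfAdjoint).2 fun x y hxy => by
      rw [inner_neg_right]
      exact eq_neg_of_add_eq_zero_right (hz_inner x y hxy)
  simpa using hT.norm_le_norm_add hz_graph

theorem IsPositive.exists_isInvOneAdd (hT : IsPositive T) :
    ∃ R : H →L[𝕜] H, IsInvOneAdd R T := by
  have : CompleteSpace T.graph := IsClosed.completeSpace_coe (hs := hT.isSelfAdjoint.isClosed)
  set e := ContinuousLinearEquiv.ofBijective (oneAdd T)
    (LinearMap.ker_eq_bot.2 hT.bijective_oneAdd.1) (LinearMap.range_eq_top.2 hT.bijective_oneAdd.2)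
  refine ⟨(ContinuousLinearMap.fst 𝕜 H H).comp
    (T.graph.subtypeL.comp e.symm.toContinuousLinearMap), fun x y =>
      ⟨fun hxy => ?_, fun h => ?_⟩⟩
  · exact congrArg (fun p : T.graph => p.1.1) (e.symm_apply_apply ⟨(x, y), hxy⟩)
  · have h_fst : (e.symm (x + y)).1.1 = x := h
    have h_add : (e.symm (x + y)).1.1 + (e.symm (x + y)).1.2 = x + y := e.apply_symm_apply (x + y)
    rw [h_fst] at h_add
    rw [← add_left_cancel h_add, ← h_fst]
    convert (e.symm (x + y)).2

theorem IsInvOneAdd.isSymmetric (hR : IsInvOneAdd R T) (hT : IsSelfAdjoint T) :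
    R.IsSymmetric := fun h k =>
  calc ⟪R h, k⟫_𝕜 = ⟪R h, k - R k⟫_𝕜 + ⟪R h, R k⟫_𝕜 := by rw [← inner_add_right, sub_add_cancel]
    _ = ⟪h - R h, R k⟫_𝕜 + ⟪R h, R k⟫_𝕜 := by
      rw [inner_eq_of_isSelfAdjoint hT (hR.mem_graph h) (hR.mem_graph k)]
    _ = ⟪h, R k⟫_𝕜 := by rw [← inner_add_left, sub_add_cancel]

theorem IsInvOneAdd.isPositive (hR : IsInvOneAdd R T) (hT : IsPositive T) : R.IsPositive := by
  refine ⟨hR.isSymmetric hT.isSelfAdjoint, fun h => ?_⟩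
  have h_eq : ⟪R h, h⟫_𝕜 = ⟪R h, h - R h⟫_𝕜 + ⟪R h, R h⟫_𝕜 := by
    rw [← inner_add_right, sub_add_cancel]
  change 0 ≤ RCLike.re ⟪R h, h⟫_𝕜
  rw [h_eq, map_add, inner_re_symm]
  exact add_nonneg (hT.re_inner_nonneg_of_mem_graph (hR.mem_graph h)) inner_self_nonneg

theorem IsInvOneAdd.isPositive_one_sub (hR : IsInvOneAdd R T) (hT : IsPositive T) :
    (1 - R).IsPositive := by
  refine ⟨LinearMap.IsSymmetric.one.sub (hR.isSymmetric hT.isSelfAdjoint), fun h => ?_⟩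
  have h_eq : ⟪h - R h, h⟫_𝕜 = ⟪h - R h, R h⟫_𝕜 + ⟪h - R h, h - R h⟫_𝕜 := by
    rw [← inner_add_right, add_sub_cancel]
  change 0 ≤ RCLike.re ⟪h - R h, h⟫_𝕜
  rw [h_eq, map_add]
  exact add_nonneg (hT.re_inner_nonneg_of_mem_graph (hR.mem_graph h)) inner_self_nonneg

end Resolvent

section Quotient

variable {𝕜 H : Type*} [RCLike 𝕜] [NormedAddCommGroup H] [InnerProductSpace 𝕜 H]

/-- The pair `C = (1 + S²)^(-1/2)`, `D = S (1 + S²)^(-1/2)` of bounded operators that encodes the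
positive operator `S = D C⁻¹`. -/
structure IsNormalizedPair (C D : H →L[𝕜] H) : Prop where
  isPositive_left : C.IsPositive
  isPositive_right : D.IsPositive
  commute : Commute C D
  mul_self_add_mul_self : C * C + D * D = 1
  injective : Function.Injective C

/-- The operator `D C⁻¹`, with graph `{(C w, D w)}`. It is a junk value unless `C` is injective. -/
noncomputable def quotient (D C : H →L[𝕜] H) : H →ₗ.[𝕜] H :=
  (C.prod D).toLinearMap.range.toLinearPMap

namespace IsNormalizedPair

variable {C D : H →L[𝕜] H}

theorem mem_graph_quotient_iff_exists (h : IsNormalizedPair C D) {u v : H} :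
    (u, v) ∈ (quotient D C).graph ↔ ∃ w, C w = u ∧ D w = v := by
  rw [quotient, Submodule.toLinearPMap_graph_eq]
  · simp
  · rintro _ ⟨w, rfl⟩ (hw : C w = 0)
    change D w = 0
    rw [(map_eq_zero_iff C h.injective).1 hw, map_zero]

theorem apply_apply_comm (h : IsNormalizedPair C D) (x : H) : C (D x) = D (C x) :=
  DFunLike.congr_fun h.commute.eq x

theorem apply_apply_add (h : IsNormalizedPair C D) (x : H) : C (C x) + D (D x) = x :=
  DFunLike.congr_fun h.mul_self_add_mul_self x

theorem mem_graph_quotient_iff (h : IsNormalizedPair C D) {u v : H} :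
    (u, v) ∈ (quotient D C).graph ↔ D u = C v := by
  rw [h.mem_graph_quotient_iff_exists]
  constructor
  · rintro ⟨w, rfl, rfl⟩
    exact (h.apply_apply_comm w).symm
  · intro huv
    refine ⟨C u + D v, ?_, ?_⟩
    · rw [map_add, h.apply_apply_comm, ← huv, h.apply_apply_add]
    · rw [map_add, ← h.apply_apply_comm, huv, h.apply_apply_add]

theorem mem_graph_prod_quotient_self_iff (h : IsNormalizedPair C D) {x y : H} :
    (x, y) ∈ (prod (quotient D C) (quotient D C)).graph ↔ C (C (x + y)) = x := by
  rw [mem_graph_prod_iff]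
  constructor
  · rintro ⟨a, hxa, hay⟩
    rw [h.mem_graph_quotient_iff] at hxa hay
    rw [map_add, ← hay, map_add, h.apply_apply_comm, ← hxa, h.apply_apply_add]
  · intro hxy
    have hy := h.apply_apply_add (x + y)
    rw [hxy, add_right_inj] at hy
    refine ⟨C (D (x + y)), ?_, ?_⟩ <;> rw [h.mem_graph_quotient_iff_exists]
    · exact ⟨C (x + y), hxy, (h.apply_apply_comm _).symm⟩
    · exact ⟨D (x + y), rfl, hy⟩

theorem prod_quotient_self_eq (h : IsNormalizedPair C D) {T : H →ₗ.[𝕜] H}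
    (hT : IsInvOneAdd (C * C) T) : prod (quotient D C) (quotient D C) = T :=
  eq_of_forall_mem_graph_iff fun x y => by
    rw [h.mem_graph_prod_quotient_self_iff, hT]; rfl

variable [CompleteSpace H]

theorem dense_domain_quotient (h : IsNormalizedPair C D) :
    Dense ((quotient D C).domain : Set H) := by
  refine dense_domain_of_forall_inner_eq_zero fun z hz => ?_
  have h_inner := hz _ _ (h.mem_graph_quotient_iff_exists.2 ⟨C z, rfl, rfl⟩)
  rw [h.isPositive_left.inner_left_eq_inner_right, inner_self_eq_zero] at h_inner
  exact (map_eq_zero_iff C h.injective).1 h_inner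

theorem isSelfAdjoint_quotient (h : IsNormalizedPair C D) : IsSelfAdjoint (quotient D C) :=
  LinearPMap.isSelfAdjoint_def.2 <| eq_of_forall_mem_graph_iff fun u v => by
    have h_apply : (∀ w, ⟪D w, u⟫_𝕜 = ⟪C w, v⟫_𝕜) ↔ D u = C v := by
      simp_rw [h.isPositive_left.inner_left_eq_inner_right,
        h.isPositive_right.inner_left_eq_inner_right]
      exact ⟨ext_inner_left 𝕜, fun huv w => by rw [huv]⟩
    rw [mem_graph_adjoint_iff h.dense_domain_quotient, h.mem_graph_quotient_iff, ← h_apply]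
    simp only [h.mem_graph_quotient_iff_exists]
    exact ⟨fun hw w => hw _ _ ⟨w, rfl, rfl⟩, fun hw _ _ ⟨w, hx, hy⟩ => hx ▸ hy ▸ hw w⟩

theorem isPositive_quotient (h : IsNormalizedPair C D) : IsPositive (quotient D C) where
  isSelfAdjoint := h.isSelfAdjoint_quotient
  re_inner_nonneg x := by
    obtain ⟨w, hCw, hDw⟩ := h.mem_graph_quotient_iff_exists.1 ((quotient D C).mem_graph x)
    rw [← hCw, ← hDw, ← h.isPositive_left.inner_left_eq_inner_right]
    exact (isPositive_mul_of_commute h.isPositive_left h.isPositive_right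
      h.commute).re_inner_nonneg_left w

end IsNormalizedPair

theorem exists_isNormalizedPair [CompleteSpace H] {R : H →L[𝕜] H} (hR : R.IsPositive)
    (hR1 : (1 - R).IsPositive) (h_inj : Function.Injective R) :
    ∃ C D, IsNormalizedPair C D ∧ C * C = R ∧ ∀ L, Commute L R → Commute L (C * D) := by
  obtain ⟨C, hC, rfl, hCc⟩ := exists_isPositive_sqrt hR
  obtain ⟨D, hD, hDD, hDc⟩ := exists_isPositive_sqrt hR1
  have h_comm {L : H →L[𝕜] H} (hL : Commute L (C * C)) : Commute L D :=
    hDc L ((Commute.one_right L).sub_right hL)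
  refine ⟨C, D, ⟨hC, hD, h_comm ((Commute.refl C).mul_right (Commute.refl C)), ?_, ?_⟩, rfl,
    fun L hL => (hCc L hL).mul_right (h_comm hL)⟩
  · rw [hDD, add_sub_cancel]
  · exact Function.Injective.of_comp (f := C) h_inj

end Quotient

section SqrtTransform

variable {𝕜 H : Type*} [RCLike 𝕜] [NormedAddCommGroup H] [InnerProductSpace 𝕜 H]

/-- `R = (1 + S²)⁻¹` and `B = S (1 + S²)⁻¹`, encoded without mentioning domains. -/
def IsSqrtTransform (B R : H → H) (S : H →ₗ.[𝕜] H) : Prop :=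
  ∀ h, (R h, B h) ∈ S.graph ∧ (B h, h - R h) ∈ S.graph

variable {S : H →ₗ.[𝕜] H}

theorem IsSqrtTransform.inner_apply_eq [CompleteSpace H] {B R : H → H}
    (hB : IsSqrtTransform B R S) (hS : IsSelfAdjoint S) (h k : H) : ⟪B h, k⟫_𝕜 = ⟪h, B k⟫_𝕜 :=
  calc ⟪B h, k⟫_𝕜 = ⟪B h, R k⟫_𝕜 + ⟪B h, k - R k⟫_𝕜 := by
        rw [← inner_add_right, add_sub_cancel]
    _ = ⟪R h, B k⟫_𝕜 + ⟪h - R h, B k⟫_𝕜 := by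
      rw [inner_eq_of_isSelfAdjoint hS (hB h).1 (hB k).1,
        inner_eq_of_isSelfAdjoint hS (hB h).2 (hB k).2]
    _ = ⟪h, B k⟫_𝕜 := by rw [← inner_add_left, add_sub_cancel]

variable {B R : H →L[𝕜] H}

theorem exists_isSqrtTransform [CompleteSpace H] (hS : IsSelfAdjoint S)
    (hR : IsInvOneAdd R (prod S S)) : ∃ B : H →L[𝕜] H, IsSqrtTransform B R S := by
  have h_exists (h : H) : ∃ b, (R h, b) ∈ S.graph ∧ (b, h - R h) ∈ S.graph :=
    mem_graph_prod_iff.1 (hR.mem_graph h)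
  have h_dom (h : H) : R h ∈ S.domain :=
    LinearPMap.mem_domain_of_mem_graph (h_exists h).choose_spec.1
  set B : H →ₗ[𝕜] H := S.toFun ∘ₗ R.toLinearMap.codRestrict S.domain h_dom
  have hB : IsSqrtTransform B R S := fun h => by
    obtain ⟨b, hb, hb'⟩ := h_exists h
    obtain rfl : b = B h := S.mem_graph_snd_inj hb (S.mem_graph ⟨R h, h_dom h⟩) rfl
    exact ⟨hb, hb'⟩
  have h_symm : B.IsSymmetric := hB.inner_apply_eq hS
  exact ⟨⟨B, h_symm.continuous⟩, hB⟩

namespace IsSqrtTransform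

theorem isPositive [CompleteSpace H] (hB : IsSqrtTransform B R S) (hS : IsPositive S) :
    B.IsPositive := by
  refine ⟨hB.inner_apply_eq hS.isSelfAdjoint, fun h => ?_⟩
  have h_eq : ⟪B h, h⟫_𝕜 = ⟪B h, R h⟫_𝕜 + ⟪B h, h - R h⟫_𝕜 := by
    rw [← inner_add_right, add_sub_cancel]
  change 0 ≤ RCLike.re ⟪B h, h⟫_𝕜
  rw [h_eq, map_add, inner_re_symm (B h) (h - R h)]
  exact add_nonneg (hS.re_inner_nonneg_of_mem_graph (hB h).1)
    (hS.re_inner_nonneg_of_mem_graph (hB h).2)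

theorem commute (hB : IsSqrtTransform B R S) (hR : IsInvOneAdd R (prod S S)) : Commute B R := by
  ext h
  have h_fst := (hB (h - R h)).1
  rw [map_sub] at h_fst
  have h_graph := mem_graph_prod_iff.2 ⟨_, (hB (R h)).2, h_fst⟩
  rw [hR, map_sub, add_sub_cancel] at h_graph
  exact h_graph.symm

theorem mul_self_eq (hB : IsSqrtTransform B R S) (hR : IsInvOneAdd R (prod S S)) :
    B * B = R * (1 - R) := by
  ext h
  have h_fst : R (B h) = B (R h) := DFunLike.congr_fun (hB.commute hR).eq.symm h
  have h_snd := S.mem_graph_snd_inj (hB (B h)).1 (hB (R h)).2 h_fst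
  simpa using h_snd

theorem apply_eq_of_mem_graph (hB : IsSqrtTransform B R S) (hR : IsInvOneAdd R (prod S S))
    {u v : H} (huv : (u, v) ∈ S.graph) : B u = R v := by
  have h_sub : (u - B v, R v) ∈ S.graph := by
    simpa using sub_mem huv (hB v).2
  have hRu : R u = u - B v := by
    simpa using (hR _ _).1 (mem_graph_prod_iff.2 ⟨_, h_sub, (hB v).1⟩)
  exact S.mem_graph_snd_inj (hB u).1 h_sub hRu

end IsSqrtTransform

end SqrtTransform

section PositiveSqrt

variable {𝕜 H : Type*} [RCLike 𝕜] [NormedAddCommGroup H] [InnerProductSpace 𝕜 H] [CompleteSpace H]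
  {S T : H →ₗ.[𝕜] H} {C D : H →L[𝕜] H}

theorem IsNormalizedPair.eq_quotient_of_isPositiveSqrt (h : IsNormalizedPair C D)
    (hT : IsInvOneAdd (C * C) T) (hS : IsPositiveSqrt S T)
    (h_comm : ∀ L, Commute L (C * C) → Commute L (C * D)) : S = quotient D C := by
  obtain ⟨hS, rfl⟩ := hS
  obtain ⟨B, hB⟩ := exists_isSqrtTransform hS.isSelfAdjoint hT
  have h_sq : B * B = C * D * (C * D) := by
    rw [hB.mul_self_eq hT, ← h.mul_self_add_mul_self, add_sub_cancel_left]
    simp only [mul_assoc, (h.commute.left_comm D)]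
  have hB_eq : B = C * D := eq_of_mul_self_eq_mul_self (hB.isPositive hS)
    (isPositive_mul_of_commute h.isPositive_left h.isPositive_right h.commute)
    (h_comm B (hB.commute hT)) h_sq
  refine eq_of_isSelfAdjoint_of_graph_le hS.isSelfAdjoint h.isSelfAdjoint_quotient ?_
  rintro ⟨u, v⟩ huv
  have h_apply := hB.apply_eq_of_mem_graph hT huv
  rw [hB_eq] at h_apply
  exact h.mem_graph_quotient_iff.2 (h.injective h_apply)

theorem IsPositive.existsUnique_isPositiveSqrt (hT : IsPositive T) :
    ∃! S, IsPositiveSqrt S T := by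
  obtain ⟨R, hR⟩ := hT.exists_isInvOneAdd
  obtain ⟨C, D, h, rfl, h_comm⟩ :=
    exists_isNormalizedPair (hR.isPositive hT) (hR.isPositive_one_sub hT) hR.injective
  exact ⟨quotient D C, ⟨h.isPositive_quotient, h.prod_quotient_self_eq hR⟩,
    fun _ hS => h.eq_quotient_of_isPositiveSqrt hR hS h_comm⟩

end PositiveSqrt

section EP

variable {𝕜 E F H : Type*} [RCLike 𝕜] [NormedAddCommGroup E] [InnerProductSpace 𝕜 E]
  [CompleteSpace E] [NormedAddCommGroup F] [InnerProductSpace 𝕜 F] [CompleteSpace F]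
  [NormedAddCommGroup H] [InnerProductSpace 𝕜 H] [CompleteSpace H]

theorem range_prod_self {S : H →ₗ.[𝕜] H} (hS : IsSelfAdjoint S)
    (hr : IsClosed (range (prod S S) : Set H)) : range (prod S S) = range S := by
  have hSS : IsPositive (prod S S) := by
    simpa only [adjoint_eq_of_isSelfAdjoint hS] using
      isPositive_prod_adjoint_self hS.dense_domain hS.isClosed
  have : CompleteSpace (range (prod S S)) := hr.completeSpace_coe
  refine le_antisymm (range_prod_le S S) fun y hy => ?_
  obtain ⟨x, hxy⟩ := mem_range_iff.1 hy
  rw [← (range (prod S S)).orthogonal_orthogonal, Submodule.mem_orthogonal]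
  intro k hk
  rw [mem_orthogonal_range_iff hSS.isSelfAdjoint.dense_domain,
    adjoint_eq_of_isSelfAdjoint hSS.isSelfAdjoint] at hk
  obtain ⟨w, hkw, hw⟩ := mem_graph_prod_iff.1 hk
  have hw0 : w = 0 := by
    rw [← inner_self_eq_zero (𝕜 := 𝕜), inner_eq_of_isSelfAdjoint hS hkw hw, inner_zero_right]
  rw [← inner_eq_of_isSelfAdjoint hS hkw hxy, hw0, inner_zero_left]

theorem isEP_of_isSelfAdjoint {T : H →ₗ.[𝕜] H} (hT : IsSelfAdjoint T)
    (hr : IsClosed (range T : Set H)) : IsEP T where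
  dense_domain := hT.dense_domain
  isClosed := hT.isClosed
  isClosed_range := hr
  range_eq := by rw [adjoint_eq_of_isSelfAdjoint hT]

theorem IsPositiveSqrt.isEP {S T : H →ₗ.[𝕜] H} (hS : IsPositiveSqrt S T)
    (hr : IsClosed (range T : Set H)) : IsEP S := by
  obtain ⟨hS, rfl⟩ := hS
  refine isEP_of_isSelfAdjoint hS.isSelfAdjoint ?_
  rwa [← range_prod_self hS.isSelfAdjoint hr]

theorem IsEP.adjoint {A : H →ₗ.[𝕜] H} (hA : IsEP A) : IsEP A† where
  dense_domain := dense_domain_adjoint hA.dense_domain hA.isClosed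
  isClosed := LinearPMap.adjoint_isClosed hA.dense_domain
  isClosed_range := hA.range_eq ▸ hA.isClosed_range
  range_eq := by rw [adjoint_adjoint_eq hA.dense_domain hA.isClosed, hA.range_eq]

variable {A : E →ₗ.[𝕜] F}

theorem isEP_prod_adjoint_self (hd : Dense (A.domain : Set E)) (hc : A.IsClosed)
    (hr : IsClosed (range A : Set F)) : IsEP (prod A† A) := by
  refine isEP_of_isSelfAdjoint (isPositive_prod_adjoint_self hd hc).isSelfAdjoint ?_
  rw [range_prod_adjoint_self hd hr]
  exact isClosed_range_adjoint hd hc hr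

theorem isEP_prod_self_adjoint (hd : Dense (A.domain : Set E)) (hc : A.IsClosed)
    (hr : IsClosed (range A : Set F)) : IsEP (prod A A†) := by
  simpa only [adjoint_adjoint_eq hd hc] using isEP_prod_adjoint_self (dense_domain_adjoint hd hc)
    (LinearPMap.adjoint_isClosed hd) (isClosed_range_adjoint hd hc hr)

end EP

end EPOperator

open EPOperator in
theorem mainTheorem5_general {𝕜 E F : Type*} [RCLike 𝕜] [NormedAddCommGroup E]
    [InnerProductSpace 𝕜 E] [CompleteSpace E] [NormedAddCommGroup F] [InnerProductSpace 𝕜 F]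
    [CompleteSpace F] {A : E →ₗ.[𝕜] F} (hd : Dense (A.domain : Set E)) (hc : A.IsClosed)
    (hr : IsClosed (range A : Set F)) :
    IsEP (prod A A†) ∧ IsEP (prod A† A) ∧
      (∃! S : E →ₗ.[𝕜] E, IsPositiveSqrt S (prod A† A)) ∧
      ∀ S : E →ₗ.[𝕜] E, IsPositiveSqrt S (prod A† A) → IsEP S :=
  have h_isEP := isEP_prod_adjoint_self hd hc hr
  ⟨isEP_prod_self_adjoint hd hc hr, h_isEP,
    (isPositive_prod_adjoint_self hd hc).existsUnique_isPositiveSqrt,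
    fun _ hS => hS.isEP h_isEP.isClosed_range⟩

theorem mainTheorem5 {𝕜 H : Type*} [RCLike 𝕜] [NormedAddCommGroup H] [InnerProductSpace 𝕜 H]
    [CompleteSpace H] (A : H →ₗ.[𝕜] H) (hA : EPOperator.IsEP A) :
    EPOperator.IsEP A† ∧
    EPOperator.IsEP (EPOperator.prod A A†) ∧
    EPOperator.IsEP (EPOperator.prod A† A) ∧
    -- the modulus of `A` is well defined, and it is EP
    (∃! S : H →ₗ.[𝕜] H, EPOperator.IsModulus S A) ∧
    (∀ S : H →ₗ.[𝕜] H, EPOperator.IsModulus S A → EPOperator.IsEP S) :=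
  ⟨hA.adjoint, mainTheorem5_general hA.dense_domain hA.isClosed hA.isClosed_range⟩
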